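/- Let $n\ge 0$. Let $\overline{B}_n$ be the group with generators $\sigma_1,\dots,\sigma_{n-1}$ and relations $\sigma_i^2=1$, and $\sigma_i\sigma_j=\sigma_j\sigma_i$ for $|i-j|>1$, and let the planar pure braid group $\overline{P}_n$ be the kernel of the homomorphism $\overline{B}_n\to S_n$, $\sigma_i\mapsto\tau_i=(i\ \,i+1)$. Encode a permutation $\alpha$ of $\{1,\dots,n\}$ by the sequence $(\alpha^{-1}(1),\dots,\alpha^{-1}(n))$; products of permutations are read from left to right, so the sequence of $\alpha\tau_k$ is that of $\alpha$ with the entries in positions $k$ and $k+1$ exchanged. For $1\le k<n$ put $I_2^\alpha=\alpha^{-1}\{k,k+1\}$ and $I_3^\alpha=\alpha^{-1}\{k+2,\dots,n\}$. The pair $[\alpha,k]$ is called essential if there is $x\in I_3^\alpha$ with $x>y$ for every $y\in I_2^\alpha$. Let $\overline{\mathcal B}_n$ be the groupoid of labelled planar braids: its objects are the permutations of $\{1,\dots,n\}$; a morphism $\alpha\to\beta$ is an element of $\overline{B}_n$ which, as a braid with strands labelled by $(\alpha^{-1}(1),\dots,\alpha^{-1}(n))$ at the top, has the labels $(\beta^{-1}(1),\dots,\beta^{-1}(n))$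 at the bottom; composition is the product in $\overline{B}_n$. The automorphism group of each object is thereby $\overline{P}_n$. Let also $[\alpha,k]\colon\alpha\to\alpha\tau_k$ denote the morphism with underlying braid $\sigma_k$. The descending spanning tree has as its root the permutation with sequence $(n,n-1,\dots,1)$; the parent of any other $\alpha$ is $\alpha\tau_i$, where $i$ is such that $\alpha^{-1}$ is decreasing on $\{i+1,\dots,n\}$ but not on $\{i,\dots,n\}$, and the edge from $\alpha$ to its parent is $[\alpha,i]$. For objects $a,\alpha$ let $t_a(\alpha)\colon a\to\alpha$ be the morphism obtained by following this tree from $a$ to $\alpha$. **Theorem.** The group $\overline{P}_n$ has a presentation with the generators $[\alpha,k]$, where $\alpha$ is a permutation of $\{1,\dots,n\}$ and $1\le k<n$, and the relations 1. $[\alpha,k]=1$ for all non-essential $[\alpha,k]$; 2. $[\alpha,k]^{-1}=[\alpha\tau_k,k]$; 3. $[\alpha,k]\,[\alpha\tau_k,l]=[\alpha,l]\,[\alpha\tau_l,k]$ for $k+1<l<n$. More precisely, for every object $a$ of $\overline{\mathcal B}_n$ there is an isomorphism from the group with this presentation onto $\mathrm{Aut}_{\overline{\mathcal B}_n}(a)=\overline{P}_n$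 that sends each generator $[\alpha,k]$ to $t_a(\alpha)\cdot[\alpha,k]\cdot t_a(\alpha\tau_k)^{-1}$. -/

import Mathlib

open CategoryTheory

namespace PlanarBraid

/-- The positions (and, equally, the labels of strands) `1, …, n` are modelled by `Fin n`; the
indices `1 ≤ k < n` of the elementary transpositions by `Fin (n - 1)`. `pos k` is the position `k`
and `posSucc k` is the position `k + 1`. -/
def pos {n : ℕ} (k : Fin (n - 1)) : Fin n := ⟨k.val, by omega⟩

/-- The position `k + 1`. -/
def posSucc {n : ℕ} (k : Fin (n - 1)) : Fin n := ⟨k.val + 1, by omega⟩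

/-- The elementary transposition `τ_k = (k  k+1)`. -/
def tau {n : ℕ} (k : Fin (n - 1)) : Equiv.Perm (Fin n) := Equiv.swap (pos k) (posSucc k)

/-! ### The planar braid group and the planar pure braid group -/

/-- The defining relations of the planar braid group (twin group). -/
inductive BraidRel (n : ℕ) : FreeGroup (Fin (n - 1)) → Prop
  | sq (i : Fin (n - 1)) : BraidRel n (FreeGroup.of i ^ 2)
  | comm (i j : Fin (n - 1)) (h : i.val + 1 < j.val ∨ j.val + 1 < i.val) :
      BraidRel n (FreeGroup.of i * FreeGroup.of j * (FreeGroup.of j * FreeGroup.of i)⁻¹)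

/-- The group of planar braids on `n` strands. -/
abbrev BraidGroup (n : ℕ) : Type := PresentedGroup {r | BraidRel n r}

/-- The generator `σ_k` of the planar braid group. -/
def sigma {n : ℕ} (k : Fin (n - 1)) : BraidGroup n := PresentedGroup.of k

lemma tau_mul_self {n : ℕ} (k : Fin (n - 1)) : tau k * tau k = 1 :=
  Equiv.swap_mul_self _ _

lemma tau_comm {n : ℕ} (i j : Fin (n - 1)) (h : i.val + 1 < j.val ∨ j.val + 1 < i.val) :
    tau i * tau j = tau j * tau i := by
  have hd : (tau i).Disjoint (tau j) := by
    intro x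
    by_cases hx : x = pos i ∨ x = posSucc i
    · right
      apply Equiv.swap_apply_of_ne_of_ne <;>
        (rcases hx with rfl | rfl <;> simp [pos, posSucc, Fin.ext_iff] <;> omega)
    · left
      push Not at hx
      exact Equiv.swap_apply_of_ne_of_ne hx.1 hx.2
  exact hd.commute

/-- The homomorphism from the planar braid group to the symmetric group, `σ_k ↦ τ_k`. -/
def toPerm (n : ℕ) : BraidGroup n →* Equiv.Perm (Fin n) :=
  PresentedGroup.toGroup (f := tau) (by
    intro r hr
    cases hr with
    | sq i => simp [pow_two, tau_mul_self]
    | comm i j h => simp only [map_mul, map_inv, FreeGroup.lift_apply_of, tau_comm i j h,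
        mul_inv_cancel])

@[simp] lemma toPerm_sigma {n : ℕ} (k : Fin (n - 1)) : toPerm n (sigma k) = tau k :=
  PresentedGroup.toGroup.of _

/-- The planar pure braid group on `n` strands. -/
def PureBraidGroup (n : ℕ) : Subgroup (BraidGroup n) := (toPerm n).ker

/-! ### The groupoid of labelled planar braids

A permutation `α` stands for the sequence of labels `(α⁻¹(1), …, α⁻¹(n))`, from left to right.
Products of permutations such as `α τ_k` are read from left to right (first `α`, then `τ_k`), so
that passing from `α` to `α τ_k` exchanges the labels in the positions `k` and `k + 1`. -/

/-- `α τ_k`: the permutation whose sequence of labels is that of `α` with the entries in the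
positions `k` and `k + 1` exchanged. -/
def mulTau {n : ℕ} (α : Equiv.Perm (Fin n)) (k : Fin (n - 1)) : Equiv.Perm (Fin n) :=
  α.trans (tau k)

/-- The objects of the groupoid of labelled planar braids: the permutations. -/
def LabelledBraids (n : ℕ) : Type := Equiv.Perm (Fin n)

/-- A planar braid with labelled strands whose labels read, from left to right,
`(α⁻¹(1), …, α⁻¹(n))` at the top and `(β⁻¹(1), …, β⁻¹(n))` at the bottom. -/
@[ext]
structure LabelledBraid {n : ℕ} (α β : Equiv.Perm (Fin n)) where
  /-- the underlying planar braid -/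
  braid : BraidGroup n
  labels : α⁻¹ * toPerm n braid = β⁻¹

instance (n : ℕ) : Groupoid (LabelledBraids n) where
  Hom α β := LabelledBraid (n := n) α β
  id α := ⟨1, by simp⟩
  comp f g := ⟨f.braid * g.braid, by rw [map_mul, ← mul_assoc, f.labels, g.labels]⟩
  id_comp f := LabelledBraid.ext (one_mul _)
  comp_id f := LabelledBraid.ext (mul_one _)
  assoc f g h := LabelledBraid.ext (mul_assoc _ _ _)
  inv f := ⟨f.braid⁻¹, by rw [← f.labels, map_inv, mul_inv_cancel_right]⟩
  inv_comp f := LabelledBraid.ext (inv_mul_cancel _)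
  comp_inv f := LabelledBraid.ext (mul_inv_cancel _)

/-- A permutation as an object of the groupoid of labelled planar braids. -/
def obj {n : ℕ} (α : Equiv.Perm (Fin n)) : LabelledBraids n := α

/-- The generator `[α, k] ∈ Hom(α, α τ_k)`, whose underlying braid is `σ_k`. -/
def gen {n : ℕ} (α : Equiv.Perm (Fin n)) (k : Fin (n - 1)) : obj α ⟶ obj (mulTau α k) :=
  ⟨sigma k, by
    rw [toPerm_sigma]
    change α⁻¹ * tau k = (tau k * α)⁻¹
    rw [mul_inv_rev, eq_comm, inv_eq_of_mul_eq_one_right (tau_mul_self k)]⟩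

/-- The automorphism group of an object (with product `f * g = f ≫ g`) is the planar pure braid
group: a labelled braid corresponds to its underlying braid. -/
def vertexGroupEquiv {n : ℕ} (a : LabelledBraids n) : (a ⟶ a) ≃* PureBraidGroup n where
  toFun f := ⟨LabelledBraid.braid f, mul_eq_left.mp (LabelledBraid.labels f)⟩
  invFun b := ⟨b.1, mul_eq_left.mpr b.2⟩
  left_inv _ := rfl
  right_inv _ := rfl
  map_mul' _ _ := rfl

/-! ### The descending spanning tree -/

/-- The root of the descending tree: the permutation `(n, n - 1, …, 1)`. -/
def root (n : ℕ) : Equiv.Perm (Fin n) := Fin.revPerm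

/-- `[α, i]` is the edge of the descending tree that leads from `α` to its parent `α τ_i`:
`α⁻¹` is decreasing on `{i + 1, …, n}` and fails to be so on `{i, …, n}`. -/
def IsParentEdge {n : ℕ} (α : Equiv.Perm (Fin n)) (i : Fin (n - 1)) : Prop :=
  StrictAntiOn (⇑α⁻¹) (Set.Ici (posSucc i)) ∧ ¬ StrictAntiOn (⇑α⁻¹) (Set.Ici (pos i))

lemma exists_isParentEdge {n : ℕ} {α : Equiv.Perm (Fin n)} (h : α ≠ root n) :
    ∃ i, IsParentEdge α i := by
  classical
  have hex : ∃ m : ℕ, StrictAntiOn (⇑α⁻¹) {j : Fin n | m ≤ j.val} :=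
    ⟨n, fun x hx => absurd x.isLt (not_lt.mpr hx)⟩
  have hlast : StrictAntiOn (⇑α⁻¹) {j : Fin n | n - 1 ≤ j.val} := by
    intro x hx y hy hxy
    simp only [Set.mem_ofPred_eq] at hx hy
    have := Fin.lt_def.mp hxy
    omega
  obtain hm | hm := Nat.eq_zero_or_pos (Nat.find hex)
  · exfalso
    apply h
    have hs := Nat.find_spec hex
    rw [hm] at hs
    have hmono : StrictMono (fun j : Fin n => α⁻¹ (Fin.rev j)) := fun x y hxy =>
      hs (by simp) (by simp) (Fin.rev_lt_rev.mpr hxy)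
    have hid : ∀ j, α⁻¹ (Fin.rev j) = j := fun j =>
      congrFun ((StrictMono.range_inj hmono strictMono_id).mp (by
        rw [Set.range_id, Set.range_eq_univ]
        exact (α⁻¹).surjective.comp Fin.rev_surjective)) j
    apply Equiv.ext
    intro j
    have hj := congrArg α (hid j)
    replace hj : Fin.rev j = α j := (α.apply_symm_apply _).symm.trans hj
    exact hj.symm
  · have hle : Nat.find hex ≤ n - 1 := Nat.find_min' hex hlast
    refine ⟨⟨Nat.find hex - 1, by omega⟩, ?_, ?_⟩
    · refine (Nat.find_spec hex).mono fun x hx => ?_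
      have := Fin.le_def.mp (Set.mem_Ici.mp hx)
      simp only [posSucc] at this
      simp only [Set.mem_ofPred_eq]
      omega
    · intro hc
      refine Nat.find_min hex (m := Nat.find hex - 1) (by omega) (hc.mono fun x hx => ?_)
      exact Set.mem_Ici.mpr (Fin.le_def.mpr hx)

lemma IsParentEdge.lt {n : ℕ} {α : Equiv.Perm (Fin n)} {i : Fin (n - 1)}
    (h : IsParentEdge α i) : α⁻¹ (pos i) < α⁻¹ (posSucc i) := by
  by_contra hc
  have hne : pos i ≠ posSucc i := by simp [pos, posSucc]
  have hgt : α⁻¹ (posSucc i) < α⁻¹ (pos i) :=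
    lt_of_le_of_ne (not_lt.mp hc) fun he => hne ((α⁻¹).injective he).symm
  apply h.2
  intro x hx y hy hxy
  have hx' := Fin.le_def.mp (Set.mem_Ici.mp hx)
  have hxy' := Fin.lt_def.mp hxy
  simp only [pos] at hx'
  have hyS : posSucc i ≤ y := by
    rw [Fin.le_def]; simp only [posSucc]; omega
  by_cases hxi : x = pos i
  · subst hxi
    obtain rfl | hlt := hyS.eq_or_lt
    · exact hgt
    · exact (h.1 Set.self_mem_Ici (Set.mem_Ici.mpr hyS) hlt).trans hgt
  · refine h.1 (Set.mem_Ici.mpr ?_) (Set.mem_Ici.mpr hyS) hxy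
    have : x.val ≠ i.val := fun he => hxi (Fin.ext he)
    rw [Fin.le_def]; simp only [posSucc]; omega

lemma IsParentEdge.toLex_lt {n : ℕ} {α : Equiv.Perm (Fin n)} {i : Fin (n - 1)}
    (h : IsParentEdge α i) :
    toLex (⇑α⁻¹) < toLex (⇑(mulTau α i)⁻¹) := by
  refine ⟨pos i, fun j hj => ?_, ?_⟩
  · change α⁻¹ j = α⁻¹ ((tau i).symm j)
    rw [tau, Equiv.symm_swap, Equiv.swap_apply_of_ne_of_ne hj.ne]
    intro he
    have := Fin.lt_def.mp hj
    rw [he] at this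
    simp [pos, posSucc] at this
  · change α⁻¹ (pos i) < α⁻¹ ((tau i).symm (pos i))
    rw [tau, Equiv.symm_swap, Equiv.swap_apply_left]
    exact h.lt

open Classical in
/-- The morphism from `α` to the root obtained by following the descending tree: the composition
of the edges that lead from each permutation to its parent. -/
noncomputable def toRoot {n : ℕ} (α : Equiv.Perm (Fin n)) : obj α ⟶ obj (root n) :=
  if h : α = root n then eqToHom (congrArg obj h)
  else
    gen α (exists_isParentEdge h).choose ≫ toRoot (mulTau α (exists_isParentEdge h).choose)
termination_by (wellFounded_gt (α := Lex (Fin n → Fin n))).wrap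
  (toLex (⇑α⁻¹))
decreasing_by exact (exists_isParentEdge h).choose_spec.toLex_lt

/-- The morphism `t(α) ∈ Hom(a, α)` obtained by following the descending tree from `a` to `α`
(through the root; a part of the path that is traversed in both directions cancels out). -/
noncomputable def treePath {n : ℕ} (a α : Equiv.Perm (Fin n)) : obj a ⟶ obj α :=
  toRoot a ≫ Groupoid.inv (toRoot α)

/-- The automorphism `t(α) · [α, k] · t(α τ_k)⁻¹` of `a` that the generator `[α, k]` of the groupoid
gives rise to. -/
noncomputable def loop {n : ℕ} (a α : Equiv.Perm (Fin n)) (k : Fin (n - 1)) : obj a ⟶ obj a :=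
  treePath a α ≫ gen α k ≫ Groupoid.inv (treePath a (mulTau α k))

/-! ### Crossing types -/

/-- A crossing type on `n` strands: an ordered partition `{1, …, n} = I₁ ⊔ I₂ ⊔ I₃`, `|I₂| = 2`. -/
structure CrossingType (n : ℕ) where
  I₁ : Finset (Fin n)
  I₂ : Finset (Fin n)
  I₃ : Finset (Fin n)
  disjoint₁₂ : Disjoint I₁ I₂
  disjoint₁₃ : Disjoint I₁ I₃
  disjoint₂₃ : Disjoint I₂ I₃
  union_eq : I₁ ∪ I₂ ∪ I₃ = Finset.univ
  card_I₂ : I₂.card = 2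

/-- A crossing type is essential if some `x ∈ I₃` is greater than every `y ∈ I₂`. -/
def CrossingType.Essential {n : ℕ} (I : CrossingType n) : Prop :=
  ∃ x ∈ I.I₃, ∀ y ∈ I.I₂, y < x

/-- The crossing type `(α⁻¹{1, …, k-1}, α⁻¹{k, k+1}, α⁻¹{k+2, …, n})` of `[α, k]`. -/
def crossingType {n : ℕ} (α : Equiv.Perm (Fin n)) (k : Fin (n - 1)) : CrossingType n where
  I₁ := (Finset.Iio (pos k)).map (α⁻¹).toEmbedding
  I₂ := ({pos k, posSucc k} : Finset (Fin n)).map (α⁻¹).toEmbedding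
  I₃ := (Finset.Ioi (posSucc k)).map (α⁻¹).toEmbedding
  disjoint₁₂ := by
    rw [Finset.disjoint_map, Finset.disjoint_left]
    intro x hx hx'
    simp [pos, posSucc, Fin.lt_def, Fin.ext_iff] at hx hx'
    omega
  disjoint₁₃ := by
    rw [Finset.disjoint_map, Finset.disjoint_left]
    intro x hx hx'
    simp [pos, posSucc, Fin.lt_def] at hx hx'
    omega
  disjoint₂₃ := by
    rw [Finset.disjoint_map, Finset.disjoint_left]
    intro x hx hx'
    simp [pos, posSucc, Fin.lt_def, Fin.ext_iff] at hx hx'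
    omega
  union_eq := by
    rw [← Finset.map_union, ← Finset.map_union, ← Finset.map_univ_equiv α⁻¹]
    congr 1
    ext x
    simp [pos, posSucc, Fin.lt_def, Fin.ext_iff]
    omega
  card_I₂ := by
    rw [Finset.card_map, Finset.card_pair]
    simp [pos, posSucc]

/-- `[α, k]` is essential if its crossing type is. -/
def Essential {n : ℕ} (α : Equiv.Perm (Fin n)) (k : Fin (n - 1)) : Prop :=
  (crossingType α k).Essential

/-! ### The presentation -/

/-- The free generator `[α, k]`. -/
def free {n : ℕ} (α : Equiv.Perm (Fin n)) (k : Fin (n - 1)) :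
    FreeGroup (Equiv.Perm (Fin n) × Fin (n - 1)) := FreeGroup.of (α, k)

/-- The relators; `u * v⁻¹` stands for the relation `u = v`. -/
inductive PureRel (n : ℕ) : FreeGroup (Equiv.Perm (Fin n) × Fin (n - 1)) → Prop
  | nonessential (α : Equiv.Perm (Fin n)) (k : Fin (n - 1)) (h : ¬ Essential α k) :
      PureRel n (free α k)
  | inverse (α : Equiv.Perm (Fin n)) (k : Fin (n - 1)) :
      PureRel n ((free α k)⁻¹ * (free (mulTau α k) k)⁻¹)
  | exchange (α : Equiv.Perm (Fin n)) (k l : Fin (n - 1)) (h : k.val + 1 < l.val) :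
      PureRel n (free α k * free (mulTau α k) l * (free α l * free (mulTau α l) k)⁻¹)

end PlanarBraid

namespace PlanarBraid

variable {n : ℕ}

/-! Write `r(α)` for `rootBraid α`, the braid of the tree path from `α` to the root. The loop of
`[α, k]` is `r(a) r(α)⁻¹ σ_k r(ατ_k) r(a)⁻¹`, so products of consecutive loops telescope and
relations 2 and 3 follow from those of the braid group. Relation 1 requires `r(α) = σ_k r(ατ_k)` for
every non-essential `[α, k]`, not only for tree edges (`rootBraid_eq_of_not_essential`): off the
tree, such an edge is a tree edge reversed, or it commutes past the first tree edge.

For bijectivity, the braid group acts from the right on pairs `(α, g)`, `g` in the presented group,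
with `σ_k` multiplying `g` by `[α, k]`; relations 2 and 3 make this an action. Tree edges are
non-essential, so tree paths leave `g` unchanged, and the image of `g` moves `(a, h)` to `(a, hg)`
(`move_toPure`). This gives injectivity. An equivariant map from the pairs to the braid group
(`move_snd`) gives surjectivity. -/

lemma tau_apply_of_lt {k : Fin (n - 1)} {j : Fin n} (h : posSucc k < j) : tau k j = j := by
  apply Equiv.swap_apply_of_ne_of_ne <;>
    simp only [pos, posSucc, Fin.lt_def, ne_eq, Fin.ext_iff] at * <;> omega

lemma tau_apply_of_gt {k : Fin (n - 1)} {j : Fin n} (h : j < pos k) : tau k j = j := by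
  apply Equiv.swap_apply_of_ne_of_ne <;>
    simp only [pos, posSucc, Fin.lt_def, ne_eq, Fin.ext_iff] at * <;> omega

lemma tau_pos (k : Fin (n - 1)) : tau k (pos k) = posSucc k := Equiv.swap_apply_left _ _

lemma tau_posSucc (k : Fin (n - 1)) : tau k (posSucc k) = pos k := Equiv.swap_apply_right _ _

lemma mulTau_inv_apply (α : Equiv.Perm (Fin n)) (k : Fin (n - 1)) (j : Fin n) :
    (mulTau α k)⁻¹ j = α⁻¹ (tau k j) := by
  change α.symm ((tau k).symm j) = α.symm (tau k j)
  rw [tau, Equiv.symm_swap]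

lemma mulTau_mulTau (α : Equiv.Perm (Fin n)) (k : Fin (n - 1)) :
    mulTau (mulTau α k) k = α := by
  ext x
  change ((tau k * tau k) (α x)).val = _
  rw [tau_mul_self]
  rfl

lemma mulTau_comm (α : Equiv.Perm (Fin n)) {k l : Fin (n - 1)}
    (h : k.val + 1 < l.val ∨ l.val + 1 < k.val) :
    mulTau (mulTau α k) l = mulTau (mulTau α l) k := by
  change tau l * (tau k * α) = tau k * (tau l * α)
  rw [← mul_assoc, ← mul_assoc, tau_comm k l h]

lemma sigma_mul_self (k : Fin (n - 1)) : (sigma k : BraidGroup n) * sigma k = 1 := by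
  have := PresentedGroup.one_of_mem (rels := {r | BraidRel n r}) (BraidRel.sq k)
  rwa [map_pow, pow_two] at this

lemma sigma_comm {k l : Fin (n - 1)} (h : k.val + 1 < l.val ∨ l.val + 1 < k.val) :
    (sigma k : BraidGroup n) * sigma l = sigma l * sigma k := by
  have := PresentedGroup.one_of_mem (rels := {r | BraidRel n r}) (BraidRel.comm k l h)
  rwa [map_mul, map_inv, mul_inv_eq_one, map_mul, map_mul] at this

/-! ### Essential generators and the descending tree -/

lemma essential_iff (α : Equiv.Perm (Fin n)) (k : Fin (n - 1)) :
    Essential α k ↔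
      ∃ j, posSucc k < j ∧ α⁻¹ (pos k) < α⁻¹ j ∧ α⁻¹ (posSucc k) < α⁻¹ j := by
  simp only [Essential, CrossingType.Essential, crossingType, Finset.mem_map, Finset.mem_Ioi,
    Finset.mem_insert, Finset.mem_singleton, forall_exists_index, and_imp, forall_eq_or_imp,
    forall_eq, Equiv.coe_toEmbedding]
  constructor
  · rintro ⟨_, ⟨j, hj, rfl⟩, h⟩
    exact ⟨j, hj, (h _).1 rfl, (h _).2 rfl⟩
  · rintro ⟨j, hj, h1, h2⟩
    exact ⟨_, ⟨j, hj, rfl⟩, fun _ => ⟨fun h => h ▸ h1, fun h => h ▸ h2⟩⟩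

/-- `τ_k` preserves `I₂` as a set and fixes every later position. -/
lemma essential_mulTau_iff (α : Equiv.Perm (Fin n)) (k : Fin (n - 1)) :
    Essential (mulTau α k) k ↔ Essential α k := by
  simp only [essential_iff, mulTau_inv_apply, tau_pos, tau_posSucc]
  refine exists_congr fun j => and_congr_right fun hj => ?_
  rw [tau_apply_of_lt hj, and_comm]

lemma posSucc_lt_tau {k l : Fin (n - 1)} (h : k.val + 1 < l.val) {j : Fin n}
    (hj : posSucc k < j) : posSucc k < tau l j := by
  unfold tau
  rw [Equiv.swap_apply_def]
  split_ifs <;> simp only [pos, posSucc, Fin.lt_def] at * <;> omega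

/-- For `l > k + 1`, `τ_l` only permutes positions beyond `k + 1`, so a witness in `I₃` stays in
`I₃`. -/
lemma Essential.of_mulTau {α : Equiv.Perm (Fin n)} {k l : Fin (n - 1)} (h : k.val + 1 < l.val)
    (he : Essential (mulTau α l) k) : Essential α k := by
  rw [essential_iff] at he ⊢
  obtain ⟨j, hj, h1, h2⟩ := he
  have hp : tau l (pos k) = pos k := tau_apply_of_gt (Fin.lt_def.mpr (by simp only [pos]; omega))
  have hq : tau l (posSucc k) = posSucc k :=
    tau_apply_of_gt (Fin.lt_def.mpr (by simp only [pos, posSucc]; omega))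
  rw [mulTau_inv_apply, mulTau_inv_apply, hp] at h1
  rw [mulTau_inv_apply, mulTau_inv_apply, hq] at h2
  exact ⟨tau l j, posSucc_lt_tau h hj, h1, h2⟩

/-- The label at position `i + 1` exceeds all later ones, as the tail from there is decreasing. -/
lemma IsParentEdge.not_essential {α : Equiv.Perm (Fin n)} {i : Fin (n - 1)}
    (h : IsParentEdge α i) : ¬ Essential α i := by
  rw [essential_iff]
  rintro ⟨j, hj, -, h2⟩
  exact lt_asymm h2 (h.1 Set.self_mem_Ici hj.le hj)

/-- A tail of a decreasing tail is decreasing, so only one position can be the boundary. Hence the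
choice made in `toRoot` is immaterial. -/
lemma IsParentEdge.unique {α : Equiv.Perm (Fin n)} {i j : Fin (n - 1)}
    (hi : IsParentEdge α i) (hj : IsParentEdge α j) : i = j := by
  have key : ∀ {i j : Fin (n - 1)}, IsParentEdge α i → IsParentEdge α j → ¬ i < j := by
    intro i j hi hj hij
    refine hj.2 (hi.1.mono (Set.Ici_subset_Ici.mpr ?_))
    simp only [pos, posSucc, Fin.le_def, Fin.lt_def] at *
    omega
  exact le_antisymm (not_lt.mp (key hj hi)) (not_lt.mp (key hi hj))

lemma IsParentEdge.ne_root {α : Equiv.Perm (Fin n)} {i : Fin (n - 1)}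
    (h : IsParentEdge α i) : α ≠ root n := by
  rintro rfl
  exact h.2 fun x _ y _ hxy => Fin.rev_lt_rev.mpr hxy

/-- A transposition to the left of a parent edge does not affect it. -/
lemma IsParentEdge.mulTau {α : Equiv.Perm (Fin n)} {k i : Fin (n - 1)} (h : k.val + 1 < i.val)
    (hi : IsParentEdge α i) : IsParentEdge (mulTau α k) i := by
  have heq : Set.EqOn (⇑α⁻¹) (⇑(PlanarBraid.mulTau α k)⁻¹) (Set.Ici (pos i)) := by
    intro x hx
    rw [mulTau_inv_apply, tau_apply_of_lt]
    simp only [Set.mem_Ici, pos, posSucc, Fin.le_def, Fin.lt_def] at *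
    omega
  have hsub : Set.Ici (posSucc i) ⊆ Set.Ici (pos i) :=
    Set.Ici_subset_Ici.mpr (by simp [pos, posSucc, Fin.le_def])
  exact ⟨hi.1.congr (heq.mono hsub), fun hc => hi.2 (hc.congr heq.symm)⟩

/-- The underlying braid of the path from `α` to the root of the descending tree. -/
noncomputable def rootBraid (α : Equiv.Perm (Fin n)) : BraidGroup n := (toRoot α).braid

lemma rootBraid_root : rootBraid (root n) = 1 := by
  rw [rootBraid, toRoot, dif_pos rfl]
  rfl

lemma IsParentEdge.rootBraid_eq {α : Equiv.Perm (Fin n)} {i : Fin (n - 1)}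
    (h : IsParentEdge α i) : rootBraid α = sigma i * rootBraid (PlanarBraid.mulTau α i) := by
  have hc := (exists_isParentEdge h.ne_root).choose_spec.unique h
  conv_lhs => rw [rootBraid, toRoot, dif_neg h.ne_root]
  change sigma _ * rootBraid (PlanarBraid.mulTau α _) = _
  rw [hc]

/-- Induction along the descending tree, from the root upwards. -/
lemma tree_induction {p : Equiv.Perm (Fin n) → Prop} (hroot : p (root n))
    (hstep : ∀ α i, IsParentEdge α i → p (mulTau α i) → p α) (α : Equiv.Perm (Fin n)) : p α := by
  induction α using
    (InvImage.wf (fun α : Equiv.Perm (Fin n) => toLex (⇑α⁻¹))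
      (wellFounded_gt (α := Lex (Fin n → Fin n)))).induction with
  | _ α ih =>
    by_cases h : α = root n
    · exact h ▸ hroot
    · obtain ⟨i, hi⟩ := exists_isParentEdge h
      exact hstep α i hi (ih _ hi.toLex_lt)

/-- At a non-essential ascent, the label at `k + 1` exceeds all later ones. Since `i + 1 ≤ k + 2`,
the tail from `k + 2` is already decreasing, hence so is the one from `k + 1`; the ascent at `k`
ends it. -/
lemma isParentEdge_of_not_essential {α : Equiv.Perm (Fin n)} {k i : Fin (n - 1)}
    (he : ¬ Essential α k) (hlt : α⁻¹ (pos k) < α⁻¹ (posSucc k)) (hi : IsParentEdge α i)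
    (hik : i.val ≤ k.val + 1) : IsParentEdge α k := by
  have hmax : ∀ j, posSucc k < j → α⁻¹ j < α⁻¹ (posSucc k) := by
    intro j hj
    refine lt_of_le_of_ne (not_lt.mp fun hc => he ?_) fun hc => hj.ne' ((α⁻¹).injective hc)
    exact (essential_iff α k).mpr ⟨j, hj, hlt.trans hc, hc⟩
  refine ⟨fun x hx y hy hxy => ?_, fun hc => ?_⟩
  · obtain rfl | hx' := (Set.mem_Ici.mp hx).eq_or_lt
    · exact hmax y hxy
    · refine hi.1 ?_ ?_ hxy <;>
        simp only [Set.mem_Ici, pos, posSucc, Fin.le_def, Fin.lt_def] at * <;> omega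
  · exact lt_asymm hlt (hc Set.self_mem_Ici (by simp [pos, posSucc, Fin.le_def])
      (by simp [pos, posSucc, Fin.lt_def]))

lemma rootBraid_eq_of_lt (α : Equiv.Perm (Fin n)) (k : Fin (n - 1)) (he : ¬ Essential α k)
    (hlt : α⁻¹ (pos k) < α⁻¹ (posSucc k)) :
    rootBraid α = sigma k * rootBraid (mulTau α k) := by
  induction α using tree_induction with
  | hroot =>
    -- The sequence of the root has no ascent.
    exact absurd hlt (not_lt.mpr (Fin.rev_le_rev.mpr (by simp [pos, posSucc, Fin.le_def])))
  | hstep α i hi ih =>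
    by_cases hik : i.val ≤ k.val + 1
    · exact (isParentEdge_of_not_essential he hlt hi hik).rootBraid_eq
    · push Not at hik
      have hp : tau i (pos k) = pos k :=
        tau_apply_of_gt (Fin.lt_def.mpr (by simp only [pos]; omega))
      have hq : tau i (posSucc k) = posSucc k :=
        tau_apply_of_gt (Fin.lt_def.mpr (by simp only [pos, posSucc]; omega))
      -- Here `i > k + 1`: `i` is also the parent edge of `ατ_k`, and the square formed by `σ_i` and
      -- `σ_k` commutes.
      rw [hi.rootBraid_eq, ih (fun h => he (h.of_mulTau hik))
        (by rwa [mulTau_inv_apply, mulTau_inv_apply, hp, hq]), (hi.mulTau hik).rootBraid_eq,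
        ← mul_assoc, ← mul_assoc, sigma_comm (Or.inl hik), mulTau_comm _ (Or.inl hik)]

/-- The non-essential edges are compatible with the paths to the root. -/
lemma rootBraid_eq_of_not_essential (α : Equiv.Perm (Fin n)) (k : Fin (n - 1))
    (he : ¬ Essential α k) : rootBraid α = sigma k * rootBraid (mulTau α k) := by
  have hne : α⁻¹ (pos k) ≠ α⁻¹ (posSucc k) := fun h => by
    simpa [pos, posSucc] using (α⁻¹).injective h
  obtain hlt | hgt := hne.lt_or_gt
  · exact rootBraid_eq_of_lt α k he hlt
  -- A descent of `α` at `k` is an ascent of `ατ_k`, and `σ_k² = 1` reverses the edge.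
  · rw [rootBraid_eq_of_lt (mulTau α k) k (mt (essential_mulTau_iff α k).mp he)
      (by rwa [mulTau_inv_apply, mulTau_inv_apply, tau_pos, tau_posSucc]), mulTau_mulTau,
      ← mul_assoc, sigma_mul_self, one_mul]

/-! ### The homomorphism from the presented group -/

/-- The group with the generators `[α, k]` and the relations of the presentation. -/
abbrev PresentedPure (n : ℕ) : Type := PresentedGroup {r | PureRel n r}

/-- The generator `[α, k]` of the presented group. -/
def pureGen (α : Equiv.Perm (Fin n)) (k : Fin (n - 1)) : PresentedPure n :=
  PresentedGroup.of (α, k)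

lemma pureGen_eq_one {α : Equiv.Perm (Fin n)} {k : Fin (n - 1)} (h : ¬ Essential α k) :
    pureGen α k = 1 :=
  PresentedGroup.one_of_mem (rels := {r | PureRel n r}) (PureRel.nonessential α k h)

lemma pureGen_mul_pureGen_mulTau (α : Equiv.Perm (Fin n)) (k : Fin (n - 1)) :
    pureGen α k * pureGen (mulTau α k) k = 1 := by
  have := PresentedGroup.one_of_mem (rels := {r | PureRel n r}) (PureRel.inverse α k)
  rw [map_mul, map_inv, map_inv, mul_inv_eq_one, inv_eq_iff_mul_eq_one] at this
  exact this

lemma pureGen_exchange (α : Equiv.Perm (Fin n)) {k l : Fin (n - 1)}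
    (h : k.val + 1 < l.val ∨ l.val + 1 < k.val) :
    pureGen α k * pureGen (mulTau α k) l = pureGen α l * pureGen (mulTau α l) k := by
  have key : ∀ {k l : Fin (n - 1)}, k.val + 1 < l.val →
      pureGen α k * pureGen (mulTau α k) l = pureGen α l * pureGen (mulTau α l) k := by
    intro k l h
    have := PresentedGroup.one_of_mem (rels := {r | PureRel n r}) (PureRel.exchange α k l h)
    rw [map_mul, map_inv, mul_inv_eq_one, map_mul, map_mul] at this
    exact this
  exact h.elim key fun h => (key h).symm

/-- The pure braid that corresponds to the automorphism `loop a α k`. -/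
noncomputable def loopBraid (a α : Equiv.Perm (Fin n)) (k : Fin (n - 1)) : PureBraidGroup n :=
  vertexGroupEquiv (obj a) (loop a α k)

lemma coe_loopBraid (a α : Equiv.Perm (Fin n)) (k : Fin (n - 1)) :
    (loopBraid a α k : BraidGroup n) = rootBraid a * (rootBraid α)⁻¹ * (sigma k *
      (rootBraid a * (rootBraid (mulTau α k))⁻¹)⁻¹) :=
  rfl

/-- The homomorphism that sends each generator `[α, k]` to the braid of `loop a α k`. -/
noncomputable def toPure (a : Equiv.Perm (Fin n)) : PresentedPure n →* PureBraidGroup n :=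
  PresentedGroup.toGroup (f := fun x => loopBraid a x.1 x.2) (by
    intro r hr
    apply Subtype.ext
    cases hr with
    | nonessential α k h =>
      simp only [free, FreeGroup.lift_apply_of, coe_loopBraid, OneMemClass.coe_one]
      rw [rootBraid_eq_of_not_essential α k h]
      group
    | inverse α k =>
      simp only [free, map_mul, map_inv, FreeGroup.lift_apply_of, Subgroup.coe_mul,
        Subgroup.coe_inv, coe_loopBraid, OneMemClass.coe_one, mulTau_mulTau]
      rw [← mul_inv_rev, inv_eq_one]
      simp only [mul_inv_rev, inv_inv, mul_assoc, inv_mul_cancel_left, mul_inv_cancel_left]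
      rw [← mul_assoc (sigma k) (sigma k), sigma_mul_self]
      group
    | exchange α k l h =>
      simp only [free, map_mul, map_inv, FreeGroup.lift_apply_of, Subgroup.coe_mul,
        Subgroup.coe_inv, coe_loopBraid, OneMemClass.coe_one, mulTau_comm α (Or.inl h)]
      rw [mul_inv_eq_one]
      simp only [mul_inv_rev, inv_inv, mul_assoc, inv_mul_cancel_left, mul_inv_cancel_left]
      rw [← mul_assoc (sigma k) (sigma l), sigma_comm (Or.inl h), mul_assoc])

lemma toPure_pureGen (a α : Equiv.Perm (Fin n)) (k : Fin (n - 1)) :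
    toPure a (pureGen α k) = loopBraid a α k :=
  PresentedGroup.toGroup.of _

/-! ### The right action of the braid group on `Perm × PresentedPure` -/

/-- The action of `σ_k`. -/
def step (k : Fin (n - 1)) : Equiv.Perm (Equiv.Perm (Fin n) × PresentedPure n) :=
  Function.Involutive.toPerm (fun x => (mulTau x.1 k, x.2 * pureGen x.1 k)) fun x => by
    simp only [mulTau_mulTau, mul_assoc, pureGen_mul_pureGen_mulTau, mul_one]

lemma step_apply (k : Fin (n - 1)) (α : Equiv.Perm (Fin n)) (g : PresentedPure n) :
    step k (α, g) = (mulTau α k, g * pureGen α k) := rfl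

lemma step_mul_self (k : Fin (n - 1)) : step k * step k = 1 :=
  Equiv.ext (Function.Involutive.toPerm_involutive _)

lemma step_comm {k l : Fin (n - 1)} (h : k.val + 1 < l.val ∨ l.val + 1 < k.val) :
    step k * step l = step l * step k := by
  ext1 ⟨α, g⟩
  simp only [Equiv.Perm.mul_apply, step_apply, mul_assoc, mulTau_comm α h, pureGen_exchange α h]

/-- The right action of the braid group on `Perm × PresentedPure`, in which `σ_k` sends `(α, g)` to
`(α τ_k, g [α, k])`. -/
def rightAction (n : ℕ) :
    BraidGroup n →* (Equiv.Perm (Equiv.Perm (Fin n) × PresentedPure n))ᵐᵒᵖ :=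
  -- A right action is a homomorphism to the opposite of the permutation group.
  PresentedGroup.toGroup (f := fun k => MulOpposite.op (step k)) (by
    intro r hr
    cases hr with
    | sq i => simp only [map_mul, FreeGroup.lift_apply_of, pow_two, ← MulOpposite.op_mul,
        step_mul_self, MulOpposite.op_one]
    | comm i j h => simp only [map_mul, map_inv, FreeGroup.lift_apply_of, ← MulOpposite.op_mul,
        step_comm h, mul_inv_cancel])

/-- The result of acting on `x` by the braid `b` from the right. -/
def move (x : Equiv.Perm (Fin n) × PresentedPure n) (b : BraidGroup n) :
    Equiv.Perm (Fin n) × PresentedPure n :=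
  (rightAction n b).unop x

lemma move_one (x : Equiv.Perm (Fin n) × PresentedPure n) : move x 1 = x := by
  simp [move]

lemma move_mul (x : Equiv.Perm (Fin n) × PresentedPure n) (b c : BraidGroup n) :
    move x (b * c) = move (move x b) c := by
  simp [move]

lemma move_sigma (α : Equiv.Perm (Fin n)) (g : PresentedPure n) (k : Fin (n - 1)) :
    move (α, g) (sigma k) = (mulTau α k, g * pureGen α k) := by
  have : rightAction n (sigma k) = MulOpposite.op (step k) := PresentedGroup.toGroup.of _
  rw [move, this]
  rfl

lemma move_eq_iff {x y : Equiv.Perm (Fin n) × PresentedPure n} {b : BraidGroup n} :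
    move x b⁻¹ = y ↔ move y b = x := by
  constructor <;> rintro rfl <;> simp [← move_mul, move_one]

lemma braid_induction {p : BraidGroup n → Prop} (hone : p 1) (hsigma : ∀ k, p (sigma k))
    (hmul : ∀ b c, p b → p c → p (b * c)) (hinv : ∀ b, p b → p b⁻¹) (b : BraidGroup n) : p b := by
  have hb : b ∈ Subgroup.closure (Set.range (PresentedGroup.of (rels := {r | BraidRel n r}))) := by
    rw [PresentedGroup.closure_range_of]; trivial
  induction hb using Subgroup.closure_induction with
  | mem x hx => obtain ⟨k, rfl⟩ := hx; exact hsigma k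
  | one => exact hone
  | mul x y _ _ hx hy => exact hmul x y hx hy
  | inv x _ hx => exact hinv x hx

/-! ### The action and the homomorphism to pure braids -/

lemma move_fst (b : BraidGroup n) (x : Equiv.Perm (Fin n) × PresentedPure n) :
    (move x b).1⁻¹ = x.1⁻¹ * toPerm n b := by
  induction b using braid_induction generalizing x with
  | hone => simp [move_one]
  | hsigma k =>
    rw [toPerm_sigma, move_sigma]
    ext1 j
    rw [mulTau_inv_apply]
    rfl
  | hmul b c hb hc => rw [move_mul, hc, hb, map_mul, mul_assoc]
  | hinv b hb =>
    have := hb (move x b⁻¹)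
    rw [← move_mul, inv_mul_cancel, move_one] at this
    rw [this, map_inv, mul_inv_cancel_right]

/-- The map `(α, g) ↦ toPure a g · r(a) r(α)⁻¹` is equivariant for right multiplication on the braid
group: for `σ_k`, the loop of `[α, k]` telescopes. -/
lemma move_snd (a : Equiv.Perm (Fin n)) (b : BraidGroup n)
    (x : Equiv.Perm (Fin n) × PresentedPure n) :
    (toPure a (move x b).2 : BraidGroup n) * rootBraid a * (rootBraid (move x b).1)⁻¹ =
      toPure a x.2 * rootBraid a * (rootBraid x.1)⁻¹ * b := by
  induction b using braid_induction generalizing x with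
  | hone => simp [move_one]
  | hsigma k =>
    rw [move_sigma, map_mul, toPure_pureGen, Subgroup.coe_mul, coe_loopBraid]
    group
  | hmul b c hb hc => rw [move_mul, hc, hb, mul_assoc]
  | hinv b hb =>
    -- The claim for `b`, applied at the point that `b` carries to `x`.
    have := hb (move x b⁻¹)
    rw [← move_mul, inv_mul_cancel, move_one] at this
    rw [this, mul_inv_cancel_right]

lemma move_rootBraid (α : Equiv.Perm (Fin n)) (g : PresentedPure n) :
    move (α, g) (rootBraid α) = (root n, g) := by
  induction α using tree_induction with
  | hroot => rw [rootBraid_root, move_one]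
  | hstep α i hi ih =>
    rw [hi.rootBraid_eq, move_mul, move_sigma, pureGen_eq_one hi.not_essential, mul_one, ih]

/-- The tree paths before and after `σ_k` do not affect the second coordinate; only `σ_k`, applied
at `α`, contributes a factor. -/
lemma move_loopBraid (a α : Equiv.Perm (Fin n)) (k : Fin (n - 1)) (g : PresentedPure n) :
    move (a, g) (loopBraid a α k) = (a, g * pureGen α k) := by
  have h : ∀ β h, move (root n, h) (rootBraid β)⁻¹ = (β, h) := fun β h =>
    move_eq_iff.mpr (move_rootBraid β h)
  rw [coe_loopBraid, mul_inv_rev, inv_inv]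
  simp only [move_mul, move_rootBraid, h, move_sigma]

lemma move_toPure (a : Equiv.Perm (Fin n)) (g h : PresentedPure n) :
    move (a, h) (toPure a g) = (a, h * g) := by
  have hg : g ∈ Subgroup.closure (Set.range (PresentedGroup.of (rels := {r | PureRel n r}))) := by
    rw [PresentedGroup.closure_range_of]; trivial
  induction hg using Subgroup.closure_induction generalizing h with
  | mem x hx =>
    obtain ⟨⟨α, k⟩, rfl⟩ := hx
    exact (congrArg (fun b : PureBraidGroup n => move (a, h) b) (toPure_pureGen a α k)).trans
      (move_loopBraid a α k h)
  | one => simp [move_one]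
  | mul x y _ _ hx hy => rw [map_mul, Subgroup.coe_mul, move_mul, hx, hy, mul_assoc]
  | inv x _ hx => rw [map_inv, Subgroup.coe_inv, move_eq_iff, hx, inv_mul_cancel_right]

/-! ### Bijectivity -/

lemma toPure_injective (a : Equiv.Perm (Fin n)) : Function.Injective (toPure a) := by
  rw [injective_iff_map_eq_one]
  intro g hg
  have := move_toPure a g 1
  rw [hg, OneMemClass.coe_one, move_one, one_mul] at this
  exact (congrArg Prod.snd this).symm

lemma toPure_surjective (a : Equiv.Perm (Fin n)) : Function.Surjective (toPure a) := by
  intro b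
  -- The preimage is the word in the `[α, k]` collected along `b` from `a`. As `b` is pure, the
  -- first coordinate returns to `a` and `r(a) r(a)⁻¹` cancels in `move_snd`.
  refine ⟨(move (a, 1) b).2, Subtype.ext ?_⟩
  have hb : toPerm n b = 1 := b.2
  have h1 : (move (a, 1) b).1 = a := by
    have := move_fst b.1 (a, 1)
    rwa [hb, mul_one, inv_inj] at this
  have h2 := move_snd a b.1 (a, 1)
  rw [h1] at h2
  simpa using h2

end PlanarBraid

theorem mainTheorem2 (n : ℕ) (a : Equiv.Perm (Fin n)) :
    ∃ Φ : PresentedGroup {r | PlanarBraid.PureRel n r} ≃* PlanarBraid.PureBraidGroup n,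
      ∀ (α : Equiv.Perm (Fin n)) (k : Fin (n - 1)),
        Φ (PresentedGroup.of (α, k)) =
          PlanarBraid.vertexGroupEquiv (PlanarBraid.obj a) (PlanarBraid.loop a α k) :=
  ⟨MulEquiv.ofBijective (PlanarBraid.toPure a)
    ⟨PlanarBraid.toPure_injective a, PlanarBraid.toPure_surjective a⟩,
    PlanarBraid.toPure_pureGen a⟩
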